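/- Let $M_0$ be the boundary of $[0,1]^2$. A \emph{square set} is a set $X$ with an injective map $S_X\colon M_0\to X$. A \emph{square metric space} is a square set $X$ with a metric $d_X\le 2$ such that $d_X(S_X(p),S_X(q))=|p-q|$ whenever $p,q$ lie on a common side of the square, and $d_X(S_X(r,s),S_X(t,u))\ge |r-t|+|s-u|$ for all $(r,s),(t,u)\in M_0$. Maps of square sets are functions $f\colon X\to Y$ with $f\circ S_X=S_Y$; the category $\mathsf{SquaMS}$ has square metric spaces as objects and as morphisms the maps of square sets that are short, i.e. $d_Y(f(x),f(y))\le d_X(x,y)$. Let $N=\{0,1,2\}^2$. For a square metric space $X$, let $N\otimes X$ be the quotient of $N\times X$ by the equivalence relation generated by $((i,j),S_X(1,r))\sim((i+1,j),S_X(0,r))$ for $i\in\{0,1\}$, $j\in\{0,1,2\}$, and $((i,j),S_X(r,1))\sim((i,j+1),S_X(r,0))$ for $i\in\{0,1,2\}$, $j\in\{0,1\}$, where $r\in[0,1]$; write $n\otimes x$ for the class of $(n,x)$. The distance on $N\otimes X$ is the infimum of the scores of finite paths in $N\times X$, where a step between $\sim$-equivalent points scores $0$, any other step from $(m,x)$ to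 $(n,y)$ scores $\frac13 d_X(x,y)$ if $m=n$ and $2$ if $m\ne n$. The boundary map of $N\otimes X$ sends $p\in M_0$ to $(i,j)\otimes S_X(3p-(i,j))$ for any $(i,j)\in N$ with $3p-(i,j)\in[0,1]^2$. With $(N\otimes f)(n\otimes x)=n\otimes f(x)$ this is a functor $N\otimes-\colon\mathsf{SquaMS}\to\mathsf{SquaMS}$. Let $U_0=[0,1]^2$ with the taxicab metric and the inclusion $S_{U_0}\colon M_0\to U_0$, and let $\alpha_N\colon N\otimes U_0\to U_0$, $\alpha_N((i,j)\otimes z)=(\tfrac i3,\tfrac j3)+\tfrac13 z$. \textbf{Theorem.} (1) $(U_0,\alpha_N)$ is a corecursive algebra for $N\otimes-$ on $\mathsf{SquaMS}$: for every coalgebra $\beta\colon B\to N\otimes B$ in $\mathsf{SquaMS}$ there is a unique morphism $\beta^\dagger\colon B\to U_0$ of $\mathsf{SquaMS}$ with $\beta^\dagger=\alpha_N\circ(N\otimes\beta^\dagger)\circ\beta$. (2) $\alpha_N$ is an isomorphism in $\mathsf{SquaMS}$, and $(U_0,\alpha_N^{-1})$ is a final coalgebra for $N\otimes-$ on $\mathsf{SquaMS}$.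 (3) For every coalgebra $\beta\colon B\to N\otimes B$ in $\mathsf{SquaMS}$ there is a unique map of square sets $f\colon B\to U_0$, not required to be short, with $f=\alpha_N\circ(N\otimes f)\circ\beta$, and this map is short. -/

import Mathlib

open CategoryTheory

universe u

noncomputable section

/-- The boundary `M₀` of the unit square `[0,1]²`. -/
def SquareBoundary : Type :=
  {p : unitInterval × unitInterval // p.1 = 0 ∨ p.1 = 1 ∨ p.2 = 0 ∨ p.2 = 1}

namespace SquareBoundary

/-- The first coordinate of a boundary point, as a real number. -/
def fst (p : SquareBoundary) : ℝ := p.1.1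

/-- The second coordinate of a boundary point, as a real number. -/
def snd (p : SquareBoundary) : ℝ := p.1.2

/-- The point `(0, r)`. -/
def left (r : unitInterval) : SquareBoundary := ⟨(0, r), Or.inl rfl⟩

/-- The point `(1, r)`. -/
def right (r : unitInterval) : SquareBoundary := ⟨(1, r), Or.inr (Or.inl rfl)⟩

/-- The point `(r, 0)`. -/
def bottom (r : unitInterval) : SquareBoundary := ⟨(r, 0), Or.inr (Or.inr (Or.inl rfl))⟩

/-- The point `(r, 1)`. -/
def top (r : unitInterval) : SquareBoundary := ⟨(r, 1), Or.inr (Or.inr (Or.inr rfl))⟩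

theorem fst_mem (p : SquareBoundary) : 0 ≤ p.fst ∧ p.fst ≤ 1 := p.1.1.2

theorem snd_mem (p : SquareBoundary) : 0 ≤ p.snd ∧ p.snd ≤ 1 := p.1.2.2

theorem ext' {p q : SquareBoundary} (h₁ : p.fst = q.fst) (h₂ : p.snd = q.snd) : p = q :=
  Subtype.ext (Prod.ext (Subtype.ext h₁) (Subtype.ext h₂))

theorem cases' (p : SquareBoundary) :
    p.fst = 0 ∨ p.fst = 1 ∨ p.snd = 0 ∨ p.snd = 1 := by
  rcases p.2 with h | h | h | h
  · left; simp [fst, h]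
  · right; left; simp [fst, h]
  · right; right; left; simp [snd, h]
  · right; right; right; simp [snd, h]

/-- The boundary point with given real coordinates. -/
def mk' (a b : ℝ) (ha : 0 ≤ a ∧ a ≤ 1) (hb : 0 ≤ b ∧ b ≤ 1)
    (h : a = 0 ∨ a = 1 ∨ b = 0 ∨ b = 1) : SquareBoundary :=
  ⟨(⟨a, ha⟩, ⟨b, hb⟩), by
    rcases h with h | h | h | h
    · left; exact Subtype.ext h
    · right; left; exact Subtype.ext h
    · right; right; left; exact Subtype.ext h
    · right; right; right; exact Subtype.ext h⟩

end SquareBoundary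

/-- A square metric space: a metric space bounded by `2`, with an injective map from the boundary
of the unit square which restricts to an isometry on each of the four sides, and is such that
distances of boundary points are bounded below by the taxicab distance. -/
structure SquaMS : Type (u + 1) where
  carrier : Type u
  [metric : MetricSpace carrier]
  S : SquareBoundary → carrier
  S_injective : Function.Injective S
  bounded : ∀ x y : carrier, dist x y ≤ 2
  sq₁_left : ∀ r s : unitInterval,
    dist (S (SquareBoundary.left r)) (S (SquareBoundary.left s)) = |(s : ℝ) - r|
  sq₁_right : ∀ r s : unitInterval,
    dist (S (SquareBoundary.right r)) (S (SquareBoundary.right s)) = |(s : ℝ) - r|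
  sq₁_bottom : ∀ r s : unitInterval,
    dist (S (SquareBoundary.bottom r)) (S (SquareBoundary.bottom s)) = |(s : ℝ) - r|
  sq₁_top : ∀ r s : unitInterval,
    dist (S (SquareBoundary.top r)) (S (SquareBoundary.top s)) = |(s : ℝ) - r|
  sq₂ : ∀ p q : SquareBoundary, |p.fst - q.fst| + |p.snd - q.snd| ≤ dist (S p) (S q)

namespace SquaMS

instance : CoeSort SquaMS.{u} (Type u) := ⟨SquaMS.carrier⟩

instance (X : SquaMS.{u}) : MetricSpace X := X.metric

/-- A morphism of the underlying square sets: a function preserving the boundary maps. -/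
@[ext]
structure SetHom (X Y : SquaMS.{u}) where
  toFun : X → Y
  map_S : ∀ p, toFun (X.S p) = Y.S p

/-- A morphism of square metric spaces: a short map preserving the boundary maps. -/
@[ext]
structure Hom (X Y : SquaMS.{u}) extends SetHom X Y where
  short : ∀ x y, dist (toFun x) (toFun y) ≤ dist x y

instance : Category SquaMS.{u} where
  Hom := Hom
  id X := ⟨⟨id, fun _ => rfl⟩, fun _ _ => le_rfl⟩
  comp f g := ⟨⟨g.toFun ∘ f.toFun, fun p => by simp [f.map_S, g.map_S]⟩,
    fun x y => (g.short _ _).trans (f.short x y)⟩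

end SquaMS

/-! ### The nine-copy functor -/

/-- The index set `N = {0,1,2}²`; the index `(i, j)` is the cell in column `i` and row `j`. -/
abbrev NIndex : Type := Fin 3 × Fin 3

/-- The generating identifications on `N × M₀`: the right side of a cell is identified with the
left side of the cell to its right, the top side with the bottom side of the cell above. -/
inductive NIndex.Adj : NIndex × SquareBoundary → NIndex × SquareBoundary → Prop
  | horizontal (i : Fin 2) (j : Fin 3) (r : unitInterval) :
      NIndex.Adj ((i.castSucc, j), SquareBoundary.right r) ((i.succ, j), SquareBoundary.left r)
  | vertical (i : Fin 3) (j : Fin 2) (r : unitInterval) :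
      NIndex.Adj ((i, j.castSucc), SquareBoundary.top r) ((i, j.succ), SquareBoundary.bottom r)

namespace SquaMS

/-- The identifications of `N × M₀`, transported to `N × X` along the boundary map of `X`. -/
def Glue (X : SquaMS.{u}) (a b : NIndex × X) : Prop :=
  ∃ p q : SquareBoundary, NIndex.Adj (a.1, p) (b.1, q) ∧ a.2 = X.S p ∧ b.2 = X.S q

/-- The equivalence relation `∼` on `N × X` generated by the identifications. -/
def glueSetoid (X : SquaMS.{u}) : Setoid (NIndex × X) := Relation.EqvGen.setoid X.Glue

/-- The underlying set of `N ⊗ X`. -/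
def Tensor (X : SquaMS.{u}) : Type u := Quotient X.glueSetoid

/-- The class `n ⊗ x`. -/
def tmul {X : SquaMS.{u}} (n : NIndex) (x : X) : Tensor X := Quotient.mk X.glueSetoid (n, x)

open scoped Classical in
/-- The metric on `N × X`: scaled by `1/3` in each copy of `X`, and `2` between distinct copies. -/
def copyDist (X : SquaMS.{u}) (a b : NIndex × X) : ℝ :=
  if a.1 = b.1 then dist a.2 b.2 / 3 else 2

open scoped Classical in
/-- The contribution of a pair of consecutive entries to the score of a path in `N × X`. -/
def stepScore (X : SquaMS.{u}) (a b : NIndex × X) : ℝ :=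
  if X.glueSetoid a b then 0 else X.copyDist a b

/-- `X.PathScore a b s` says that `s` is the score of some finite path from `a` to `b`
in `N × X`. -/
inductive PathScore (X : SquaMS.{u}) : NIndex × X → NIndex × X → ℝ → Prop
  | nil (a : NIndex × X) : PathScore X a a 0
  | cons (a b c : NIndex × X) (s : ℝ) (h : PathScore X b c s) :
      PathScore X a c (X.stepScore a b + s)

/-- The quotient distance on `N ⊗ X`: the infimum of the scores of finite paths. -/
def tensorDist (X : SquaMS.{u}) (u v : Tensor X) : ℝ :=
  sInf {s | ∃ a b : NIndex × X, tmul a.1 a.2 = u ∧ tmul b.1 b.2 = v ∧ X.PathScore a b s}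

end SquaMS

namespace SquareBoundary

/-- For `t ∈ [0,1]`, an `i ∈ {0,1,2}` with `i/3 ≤ t ≤ (i+1)/3`. -/
def digit (t : ℝ) : Fin 3 := if t ≤ 1 / 3 then 0 else if t ≤ 2 / 3 then 1 else 2

theorem digit_spec {t : ℝ} (ht : 0 ≤ t ∧ t ≤ 1) :
    0 ≤ 3 * t - ((digit t : ℕ) : ℝ) ∧ 3 * t - ((digit t : ℕ) : ℝ) ≤ 1 := by
  unfold digit
  obtain ⟨h0, h1⟩ := ht
  split_ifs with h h' <;> norm_num <;> constructor <;> linarith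

/-- The index of a cell whose boundary contains the boundary point `p` of the `3 × 3` grid. -/
def cell (p : SquareBoundary) : NIndex := (digit p.fst, digit p.snd)

/-- The position of `p` in the cell `p.cell`, after rescaling by `3`. -/
def local' (p : SquareBoundary) : SquareBoundary :=
  mk' (3 * p.fst - ((digit p.fst : ℕ) : ℝ)) (3 * p.snd - ((digit p.snd : ℕ) : ℝ))
    (digit_spec p.fst_mem) (digit_spec p.snd_mem) (by
      rcases p.cases' with h | h | h | h
      · left; simp [h, digit]
      · right; left; rw [h]; norm_num [digit]
      · right; right; left; simp [h, digit]
      · right; right; right; rw [h]; norm_num [digit])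

end SquareBoundary

namespace NIndex

open SquareBoundary

/-- The coordinates of a boundary point of a cell in the `3 × 3` grid (of side `3`). -/
def pos (a : NIndex × SquareBoundary) : ℝ × ℝ :=
  (((a.1.1 : ℕ) : ℝ) + a.2.fst, ((a.1.2 : ℕ) : ℝ) + a.2.snd)

theorem Adj.pos_eq {a b : NIndex × SquareBoundary} (h : Adj a b) : pos a = pos b := by
  cases h <;> simp [pos, SquareBoundary.left, SquareBoundary.right, SquareBoundary.top,
    SquareBoundary.bottom, SquareBoundary.fst, SquareBoundary.snd]

theorem coord_cases (i k : Fin 3) {a b : ℝ} (ha : 0 ≤ a ∧ a ≤ 1) (hb : 0 ≤ b ∧ b ≤ 1)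
    (h : ((i : ℕ) : ℝ) + a = ((k : ℕ) : ℝ) + b) :
    (i = k ∧ a = b) ∨ (∃ l : Fin 2, i = l.castSucc ∧ k = l.succ ∧ a = 1 ∧ b = 0) ∨
      (∃ l : Fin 2, k = l.castSucc ∧ i = l.succ ∧ b = 1 ∧ a = 0) := by
  obtain ⟨ha0, ha1⟩ := ha
  obtain ⟨hb0, hb1⟩ := hb
  fin_cases i <;> fin_cases k <;> norm_num at h
  · left; exact ⟨rfl, h⟩
  · right; left; exact ⟨0, rfl, rfl, by linarith, by linarith⟩
  · exfalso; linarith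
  · right; right; exact ⟨0, rfl, rfl, by linarith, by linarith⟩
  · left; exact ⟨rfl, h⟩
  · right; left; exact ⟨1, rfl, rfl, by linarith, by linarith⟩
  · exfalso; linarith
  · right; right; exact ⟨1, rfl, rfl, by linarith, by linarith⟩
  · left; exact ⟨rfl, h⟩

theorem horizontal_step (i k j : Fin 3) (p q : SquareBoundary) (hs : p.snd = q.snd)
    (h : ((i : ℕ) : ℝ) + p.fst = ((k : ℕ) : ℝ) + q.fst) :
    Relation.EqvGen Adj ((i, j), p) ((k, j), q) := by
  have hp : ∀ p : SquareBoundary, p.fst = 1 → p = SquareBoundary.right p.1.2 :=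
    fun p hp => ext' hp rfl
  have hq : ∀ p : SquareBoundary, p.fst = 0 → p = SquareBoundary.left p.1.2 :=
    fun p hp => ext' hp rfl
  have hs' : p.1.2 = q.1.2 := Subtype.ext hs
  rcases coord_cases i k p.fst_mem q.fst_mem h with ⟨rfl, h'⟩ | ⟨l, rfl, rfl, h1, h0⟩ |
      ⟨l, rfl, rfl, h1, h0⟩
  · rw [ext' h' hs]; exact Relation.EqvGen.refl _
  · rw [hp p h1, hq q h0, hs']; exact Relation.EqvGen.rel _ _ (Adj.horizontal l j _)
  · rw [hp q h1, hq p h0, hs']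
    exact Relation.EqvGen.symm _ _ (Relation.EqvGen.rel _ _ (Adj.horizontal l j _))

theorem vertical_step (i j l : Fin 3) (p q : SquareBoundary) (hs : p.fst = q.fst)
    (h : ((j : ℕ) : ℝ) + p.snd = ((l : ℕ) : ℝ) + q.snd) :
    Relation.EqvGen Adj ((i, j), p) ((i, l), q) := by
  have hp : ∀ p : SquareBoundary, p.snd = 1 → p = SquareBoundary.top p.1.1 :=
    fun p hp => ext' rfl hp
  have hq : ∀ p : SquareBoundary, p.snd = 0 → p = SquareBoundary.bottom p.1.1 :=
    fun p hp => ext' rfl hp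
  have hs' : p.1.1 = q.1.1 := Subtype.ext hs
  rcases coord_cases j l p.snd_mem q.snd_mem h with ⟨rfl, h'⟩ | ⟨l, rfl, rfl, h1, h0⟩ |
      ⟨l, rfl, rfl, h1, h0⟩
  · rw [ext' hs h']; exact Relation.EqvGen.refl _
  · rw [hp p h1, hq q h0, hs']; exact Relation.EqvGen.rel _ _ (Adj.vertical i l _)
  · rw [hp q h1, hq p h0, hs']
    exact Relation.EqvGen.symm _ _ (Relation.EqvGen.rel _ _ (Adj.vertical i l _))

theorem eqvGen_of_pos_eq {a b : NIndex × SquareBoundary} (h : pos a = pos b) :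
    Relation.EqvGen Adj a b := by
  obtain ⟨⟨i, j⟩, p⟩ := a
  obtain ⟨⟨k, l⟩, q⟩ := b
  obtain ⟨h1, h2⟩ := Prod.ext_iff.1 h
  simp only [pos] at h1 h2
  have hm : q.fst = 0 ∨ q.fst = 1 ∨ p.snd = 0 ∨ p.snd = 1 := by
    rcases coord_cases i k p.fst_mem q.fst_mem h1 with ⟨_, h'⟩ | ⟨_, _, _, _, h'⟩ |
      ⟨_, _, _, h', _⟩
    · rw [← h']; exact p.cases'
    · exact Or.inl h'
    · exact Or.inr (Or.inl h')
  let m := mk' q.fst p.snd q.fst_mem p.snd_mem hm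
  exact Relation.EqvGen.trans _ ((k, j), m) _ (horizontal_step i k j p m rfl h1)
    (vertical_step k j l m q rfl h2)

end NIndex

namespace SquaMS

variable {X Y : SquaMS.{u}}

theorem glue_of_eqvGen {a b : NIndex × SquareBoundary} (h : Relation.EqvGen NIndex.Adj a b) :
    X.glueSetoid (a.1, X.S a.2) (b.1, X.S b.2) := by
  induction h with
  | rel a b h => exact Relation.EqvGen.rel _ _ ⟨a.2, b.2, h, rfl, rfl⟩
  | refl a => exact Relation.EqvGen.refl _
  | symm a b _ ih => exact Relation.EqvGen.symm _ _ ih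
  | trans a b c _ _ ih ih' => exact Relation.EqvGen.trans _ _ _ ih ih'

theorem tmul_eq_of_pos {m n : NIndex} {p q : SquareBoundary}
    (h : NIndex.pos (m, p) = NIndex.pos (n, q)) :
    (tmul m (X.S p) : Tensor X) = tmul n (X.S q) :=
  Quotient.sound (s := X.glueSetoid) (glue_of_eqvGen (NIndex.eqvGen_of_pos_eq h))

theorem tmul_eq_of_glue {a b : NIndex × X} (h : X.glueSetoid a b) :
    (tmul a.1 a.2 : Tensor X) = tmul b.1 b.2 :=
  Quotient.sound (s := X.glueSetoid) h

theorem glue_of_tmul_eq {a b : NIndex × X} (h : (tmul a.1 a.2 : Tensor X) = tmul b.1 b.2) :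
    X.glueSetoid a b :=
  Quotient.exact (s := X.glueSetoid) h

theorem exists_rep (u : Tensor X) : ∃ a : NIndex × X, tmul a.1 a.2 = u :=
  Quotient.exists_rep u

/-- A function on `N × X` which respects the identifications descends to `N ⊗ X`. -/
def tensorLift {T : Type*} (F : NIndex × X → T) (hF : ∀ a b, X.Glue a b → F a = F b) :
    Tensor X → T :=
  Quotient.lift F fun a b (h : Relation.EqvGen X.Glue a b) => by
    induction h with
    | rel a b h => exact hF a b h
    | refl a => rfl
    | symm a b _ ih => exact ih.symm
    | trans a b c _ _ ih ih' => exact ih.trans ih'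

@[simp]
theorem tensorLift_tmul {T : Type*} (F : NIndex × X → T) (hF : ∀ a b, X.Glue a b → F a = F b)
    (n : NIndex) (x : X) : tensorLift F hF (tmul n x) = F (n, x) := rfl

/-- The map `N ⊗ f : n ⊗ x ↦ n ⊗ f x`, for a morphism `f` of square sets. -/
def tensorMap (f : SetHom X Y) : Tensor X → Tensor Y :=
  tensorLift (fun a => tmul a.1 (f.toFun a.2)) (by
    rintro ⟨m, x⟩ ⟨n, y⟩ ⟨p, q, h, hx, hy⟩
    simp only at h hx hy
    subst hx hy
    rw [f.map_S, f.map_S]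
    exact tmul_eq_of_pos h.pos_eq)

@[simp]
theorem tensorMap_tmul (f : SetHom X Y) (n : NIndex) (x : X) :
    tensorMap f (tmul n x) = tmul n (f.toFun x) := rfl

/-! ### The quotient distance is a metric -/

theorem copyDist_nonneg (a b : NIndex × X) : 0 ≤ X.copyDist a b := by
  unfold copyDist; split_ifs <;> positivity

theorem copyDist_le_two (a b : NIndex × X) : X.copyDist a b ≤ 2 := by
  unfold copyDist; split_ifs
  · linarith [X.bounded a.2 b.2]
  · exact le_rfl

theorem copyDist_comm (a b : NIndex × X) : X.copyDist a b = X.copyDist b a := by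
  simp only [copyDist, dist_comm a.2, eq_comm (a := a.1)]

theorem stepScore_nonneg (a b : NIndex × X) : 0 ≤ X.stepScore a b := by
  unfold stepScore; split_ifs
  · exact le_rfl
  · exact copyDist_nonneg a b

theorem stepScore_le (a b : NIndex × X) : X.stepScore a b ≤ X.copyDist a b := by
  unfold stepScore; split_ifs
  · exact copyDist_nonneg a b
  · exact le_rfl

theorem stepScore_comm (a b : NIndex × X) : X.stepScore a b = X.stepScore b a := by
  unfold stepScore
  by_cases h : X.glueSetoid a b
  · rw [if_pos h, if_pos (X.glueSetoid.symm h)]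
  · rw [if_neg h, if_neg fun h' => h (X.glueSetoid.symm h'), copyDist_comm]

theorem stepScore_of_glue {a b : NIndex × X} (h : X.glueSetoid a b) : X.stepScore a b = 0 :=
  if_pos h

theorem PathScore.nonneg {a b : NIndex × X} {s : ℝ} (h : X.PathScore a b s) : 0 ≤ s := by
  induction h with
  | nil a => exact le_rfl
  | cons a b c s _ ih => exact add_nonneg (stepScore_nonneg a b) ih

theorem PathScore.append {a b c : NIndex × X} {s t : ℝ} (h : X.PathScore a b s)
    (h' : X.PathScore b c t) : X.PathScore a c (s + t) := by
  induction h with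
  | nil a => simpa using h'
  | cons a b d s _ ih => rw [add_assoc]; exact PathScore.cons _ _ _ _ (ih h')

theorem PathScore.single (a b : NIndex × X) : X.PathScore a b (X.stepScore a b) := by
  simpa using PathScore.cons a b b 0 (PathScore.nil b)

theorem PathScore.symm {a b : NIndex × X} {s : ℝ} (h : X.PathScore a b s) :
    X.PathScore b a s := by
  induction h with
  | nil a => exact PathScore.nil a
  | cons a b c s _ ih =>
    rw [add_comm, stepScore_comm]; exact ih.append (PathScore.single b a)

theorem tensorDist_le_of_path {a b : NIndex × X} {s : ℝ} (h : X.PathScore a b s) :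
    X.tensorDist (tmul a.1 a.2) (tmul b.1 b.2) ≤ s :=
  csInf_le ⟨0, by rintro _ ⟨_, _, _, _, h⟩; exact h.nonneg⟩ ⟨a, b, rfl, rfl, h⟩

theorem tensorDist_le_copyDist (a b : NIndex × X) :
    X.tensorDist (tmul a.1 a.2) (tmul b.1 b.2) ≤ X.copyDist a b :=
  (tensorDist_le_of_path (PathScore.single a b)).trans (stepScore_le a b)

theorem tensorDist_same (n : NIndex) (x y : X) :
    X.tensorDist (tmul n x) (tmul n y) ≤ dist x y / 3 := by
  simpa [copyDist] using tensorDist_le_copyDist (n, x) (n, y)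

theorem tensorDist_nonempty (u v : Tensor X) :
    {s | ∃ a b : NIndex × X, tmul a.1 a.2 = u ∧ tmul b.1 b.2 = v ∧
      X.PathScore a b s}.Nonempty := by
  obtain ⟨a, ha⟩ := exists_rep u
  obtain ⟨b, hb⟩ := exists_rep v
  exact ⟨_, a, b, ha, hb, PathScore.single a b⟩

theorem tensorDist_nonneg (u v : Tensor X) : 0 ≤ X.tensorDist u v :=
  le_csInf (tensorDist_nonempty u v) (by rintro _ ⟨_, _, _, _, h⟩; exact h.nonneg)

theorem tensorDist_self (u : Tensor X) : X.tensorDist u u = 0 := by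
  obtain ⟨a, rfl⟩ := exists_rep u
  exact le_antisymm (tensorDist_le_of_path (PathScore.nil a)) (tensorDist_nonneg _ _)

theorem tensorDist_comm (u v : Tensor X) : X.tensorDist u v = X.tensorDist v u := by
  unfold tensorDist
  congr 1
  ext s
  constructor <;> rintro ⟨a, b, ha, hb, h⟩ <;> exact ⟨b, a, hb, ha, h.symm⟩

theorem tensorDist_triangle (u v w : Tensor X) :
    X.tensorDist u w ≤ X.tensorDist u v + X.tensorDist v w := by
  refine le_of_forall_pos_le_add fun ε hε => ?_
  obtain ⟨s, ⟨a, b, rfl, rfl, h⟩, hs⟩ :=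
    exists_lt_of_csInf_lt (tensorDist_nonempty u v)
      (show X.tensorDist u v < X.tensorDist u v + ε / 2 by linarith)
  obtain ⟨t, ⟨b', c, hb, rfl, h'⟩, ht⟩ :=
    exists_lt_of_csInf_lt (tensorDist_nonempty (tmul b.1 b.2) w)
      (show X.tensorDist (tmul b.1 b.2) w < X.tensorDist (tmul b.1 b.2) w + ε / 2 by linarith)
  have hbb : X.PathScore b b' 0 := by
    simpa [stepScore_of_glue (glue_of_tmul_eq hb.symm)] using PathScore.single b b'
  have := tensorDist_le_of_path (h.append (hbb.append h'))
  linarith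

/-- A function which is short in each step is short for the quotient distance. -/
theorem dist_le_tensorDist {T : Type*} [PseudoMetricSpace T] (F : Tensor X → T)
    (hF : ∀ a b : NIndex × X, dist (F (tmul a.1 a.2)) (F (tmul b.1 b.2)) ≤ X.copyDist a b)
    (u v : Tensor X) : dist (F u) (F v) ≤ X.tensorDist u v := by
  refine le_csInf (tensorDist_nonempty u v) ?_
  rintro s ⟨a, b, rfl, rfl, h⟩
  induction h with
  | nil a => simp
  | cons a b c s _ ih =>
    refine (dist_triangle _ (F (tmul b.1 b.2)) _).trans (add_le_add ?_ ih)
    unfold stepScore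
    split_ifs with h
    · rw [tmul_eq_of_glue h, dist_self]
    · exact hF a b

/-- Extension of the coordinate function `c₁ r + c₂ s` from the boundary to all of `X`. -/
theorem exists_coord (X : SquaMS.{u}) (c₁ c₂ : ℝ) (h₁ : c₁ = 1 ∨ c₁ = -1)
    (h₂ : c₂ = 1 ∨ c₂ = -1) :
    ∃ g : X → ℝ, (∀ x y, |g x - g y| ≤ dist x y) ∧
      (∀ p, g (X.S p) = c₁ * p.fst + c₂ * p.snd) ∧
      ∀ x, (c₁ - 1) / 2 + (c₂ - 1) / 2 ≤ g x ∧ g x ≤ (c₁ + 1) / 2 + (c₂ + 1) / 2 := by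
  let f : X → ℝ := Function.extend X.S (fun p => c₁ * p.fst + c₂ * p.snd) 0
  have hf : ∀ p, f (X.S p) = c₁ * p.fst + c₂ * p.snd :=
    fun p => X.S_injective.extend_apply _ _ _
  have hL : LipschitzOnWith 1 f (Set.range X.S) := by
    refine LipschitzOnWith.of_dist_le_mul ?_
    rintro _ ⟨p, rfl⟩ _ ⟨q, rfl⟩
    rw [hf, hf, Real.dist_eq]
    refine le_trans ?_ ((X.sq₂ p q).trans (by simp))
    have e1 := le_abs_self (p.fst - q.fst)
    have e2 := neg_abs_le (p.fst - q.fst)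
    have e3 := le_abs_self (p.snd - q.snd)
    have e4 := neg_abs_le (p.snd - q.snd)
    rw [abs_le]
    rcases h₁ with rfl | rfl <;> rcases h₂ with rfl | rfl <;> constructor <;> linarith
  obtain ⟨g, hg, hgf⟩ := hL.extend_real
  set lo := (c₁ - 1) / 2 + (c₂ - 1) / 2 with hlo
  set hi := (c₁ + 1) / 2 + (c₂ + 1) / 2 with hhi
  have hlohi : lo ≤ hi := by rw [hlo, hhi]; linarith
  refine ⟨fun x => max lo (min hi (g x)), fun x y => ?_, fun p => ?_, fun x => ?_⟩
  · have hG : LipschitzWith 1 fun x => max lo (min hi (g x)) := (hg.const_min hi).const_max lo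
    simpa [Real.dist_eq] using hG.dist_le_mul x y
  · have : g (X.S p) = c₁ * p.fst + c₂ * p.snd := by
      rw [← hgf (Set.mem_range_self p), hf]
    simp only [this]
    have e1 := p.fst_mem
    have e2 := p.snd_mem
    rw [min_eq_right, max_eq_right]
    · rw [hlo]; rcases h₁ with rfl | rfl <;> rcases h₂ with rfl | rfl <;> linarith
    · rw [hhi]; rcases h₁ with rfl | rfl <;> rcases h₂ with rfl | rfl <;> linarith
  · exact ⟨le_max_left _ _, max_le hlohi (min_le_left _ _)⟩

theorem coord_le_tensorDist (c₁ c₂ : ℝ) (h₁ : c₁ = 1 ∨ c₁ = -1) (h₂ : c₂ = 1 ∨ c₂ = -1)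
    (m n : NIndex) (p q : SquareBoundary) :
    c₁ * ((NIndex.pos (m, p)).1 - (NIndex.pos (n, q)).1) +
        c₂ * ((NIndex.pos (m, p)).2 - (NIndex.pos (n, q)).2) ≤
      3 * X.tensorDist (tmul m (X.S p)) (tmul n (X.S q)) := by
  obtain ⟨g, hg, hgS, hgb⟩ := exists_coord X c₁ c₂ h₁ h₂
  let F : Tensor X → ℝ := tensorLift
    (fun a => (c₁ * ((a.1.1 : ℕ) : ℝ) + c₂ * ((a.1.2 : ℕ) : ℝ) + g a.2) / 3) (by
      rintro ⟨m, x⟩ ⟨n, y⟩ ⟨p, q, h, hx, hy⟩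
      simp only at h hx hy
      subst hx hy
      obtain ⟨e1, e2⟩ := Prod.ext_iff.1 h.pos_eq
      simp only [NIndex.pos] at e1 e2
      simp only [hgS]
      linear_combination (c₁ * e1 + c₂ * e2) / 3)
  have hF := dist_le_tensorDist F (by
    rintro ⟨⟨i, j⟩, x⟩ ⟨⟨k, l⟩, y⟩
    rw [Real.dist_eq]
    simp only [F, tensorLift_tmul, copyDist]
    split_ifs with h
    · obtain ⟨rfl, rfl⟩ := Prod.ext_iff.1 h
      have := hg x y
      rw [abs_le] at this ⊢
      constructor <;> linarith
    · have hb : ∀ i : Fin 3, (0 : ℝ) ≤ ((i : ℕ) : ℝ) ∧ ((i : ℕ) : ℝ) ≤ 2 := by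
        intro i; fin_cases i <;> norm_num
      have b1 := hb i
      have b2 := hb j
      have b3 := hb k
      have b4 := hb l
      have b5 := hgb x
      have b6 := hgb y
      rw [abs_le]
      rcases h₁ with rfl | rfl <;> rcases h₂ with rfl | rfl <;> constructor <;> linarith)
    (tmul m (X.S p)) (tmul n (X.S q))
  rw [Real.dist_eq] at hF
  have := (le_abs_self _).trans hF
  simp only [F, tensorLift_tmul, hgS] at this
  simp only [NIndex.pos]
  linarith

theorem taxicab_le_tensorDist (m n : NIndex) (p q : SquareBoundary) :
    |(NIndex.pos (m, p)).1 - (NIndex.pos (n, q)).1| +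
        |(NIndex.pos (m, p)).2 - (NIndex.pos (n, q)).2| ≤
      3 * X.tensorDist (tmul m (X.S p)) (tmul n (X.S q)) := by
  have a1 := coord_le_tensorDist (X := X) 1 1 (.inl rfl) (.inl rfl) m n p q
  have a2 := coord_le_tensorDist (X := X) 1 (-1) (.inl rfl) (.inr rfl) m n p q
  have a3 := coord_le_tensorDist (X := X) (-1) 1 (.inr rfl) (.inl rfl) m n p q
  have a4 := coord_le_tensorDist (X := X) (-1) (-1) (.inr rfl) (.inr rfl) m n p q
  rcases abs_cases ((NIndex.pos (m, p)).1 - (NIndex.pos (n, q)).1) with ⟨e, _⟩ | ⟨e, _⟩ <;>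
  rcases abs_cases ((NIndex.pos (m, p)).2 - (NIndex.pos (n, q)).2) with ⟨e', _⟩ | ⟨e', _⟩ <;>
  rw [e, e'] <;> linarith

theorem isClosed_range_S (X : SquaMS.{u}) : IsClosed (Set.range X.S) := by
  have key : ∀ φ : unitInterval → SquareBoundary,
      (∀ r s, dist (X.S (φ r)) (X.S (φ s)) = |(s : ℝ) - r|) →
      IsClosed (Set.range (X.S ∘ φ)) := by
    intro φ h
    have hi : Isometry (X.S ∘ φ) := Isometry.of_dist_eq fun r s => by
      rw [Function.comp, Function.comp, h, Subtype.dist_eq, Real.dist_eq, abs_sub_comm]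
    exact (isCompact_range hi.continuous).isClosed
  have : Set.range X.S = (Set.range (X.S ∘ SquareBoundary.left) ∪
      Set.range (X.S ∘ SquareBoundary.right)) ∪ (Set.range (X.S ∘ SquareBoundary.bottom) ∪
      Set.range (X.S ∘ SquareBoundary.top)) := by
    apply Set.Subset.antisymm
    · rintro _ ⟨p, rfl⟩
      obtain ⟨⟨r, s⟩, h⟩ := p
      rcases h with h | h | h | h <;> simp only at h <;> subst h
      · exact Or.inl (Or.inl ⟨s, rfl⟩)
      · exact Or.inl (Or.inr ⟨s, rfl⟩)
      · exact Or.inr (Or.inl ⟨r, rfl⟩)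
      · exact Or.inr (Or.inr ⟨r, rfl⟩)
    · rintro _ ((⟨r, rfl⟩ | ⟨r, rfl⟩) | (⟨r, rfl⟩ | ⟨r, rfl⟩)) <;> exact ⟨_, rfl⟩
  rw [this]
  exact ((key _ X.sq₁_left).union (key _ X.sq₁_right)).union
    ((key _ X.sq₁_bottom).union (key _ X.sq₁_top))

theorem eq_of_tensorDist_eq_zero_of_notMem {a b : NIndex × X} (ha : a.2 ∉ Set.range X.S)
    (h : X.tensorDist (tmul a.1 a.2) (tmul b.1 b.2) = 0) : a = b := by
  classical
  obtain ⟨m, x⟩ := a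
  obtain ⟨n, y⟩ := b
  obtain ⟨ε, hε, hball⟩ := Metric.isOpen_iff.1 X.isClosed_range_S.isOpen_compl x ha
  have hS : ∀ p, min ε 1 ≤ dist x (X.S p) := by
    intro p
    by_contra hlt
    have : X.S p ∈ Metric.ball x ε := by
      rw [Metric.mem_ball, dist_comm]
      exact (not_le.1 hlt).trans_le (min_le_left _ _)
    exact hball this ⟨p, rfl⟩
  set ρ := min ε 1 with hρ
  have hρ0 : 0 < ρ := lt_min hε one_pos
  have hρ1 : ρ ≤ 1 := min_le_right _ _
  let G : NIndex × X → ℝ := fun c => if c.1 = m then max 0 (ρ - dist x c.2) / 3 else 0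
  have hGS : ∀ c p, c.2 = X.S p → G c = 0 := by
    intro c p hc
    simp only [G]
    split_ifs
    · rw [max_eq_left, zero_div]
      rw [hc]; linarith [hS p]
    · rfl
  have hGb : ∀ c, 0 ≤ G c ∧ G c ≤ 1 := by
    intro c
    simp only [G]
    split_ifs
    · have : max 0 (ρ - dist x c.2) ≤ 1 :=
        max_le zero_le_one (by linarith [dist_nonneg (x := x) (y := c.2)])
      exact ⟨by positivity, by linarith⟩
    · simp
  let F : Tensor X → ℝ := tensorLift G (by
    rintro c d ⟨p, q, _, hc, hd⟩
    rw [hGS c p hc, hGS d q hd])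
  have hF := dist_le_tensorDist F (by
    rintro ⟨k, z⟩ ⟨l, w⟩
    rw [Real.dist_eq]
    change |G (k, z) - G (l, w)| ≤ _
    simp only [copyDist]
    split_ifs with hkl
    · subst hkl
      simp only [G]
      split_ifs
      · rw [← sub_div, abs_div, abs_of_pos (by norm_num : (0 : ℝ) < 3)]
        gcongr
        have h1 := abs_le.1 (abs_dist_sub_le z w x)
        rw [dist_comm z x, dist_comm w x] at h1
        rw [abs_le]
        rcases max_cases 0 (ρ - dist x z) with h2 | h2 <;>
          rcases max_cases 0 (ρ - dist x w) with h3 | h3 <;>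
          constructor <;> linarith [h1.1, h1.2, h2.1, h2.2, h3.1, h3.2]
      · simp only [sub_zero, abs_zero]; positivity
    · have h1 := hGb (k, z)
      have h2 := hGb (l, w)
      rw [abs_le]
      constructor <;> linarith) (tmul m x) (tmul n y)
  rw [h, Real.dist_eq] at hF
  have hGe : G (m, x) = G (n, y) := by
    have := abs_eq_zero.1 (le_antisymm hF (abs_nonneg _))
    change G (m, x) - G (n, y) = 0 at this
    linarith
  have hx : G (m, x) = ρ / 3 := by simp [G, hρ0.le]
  rw [hx] at hGe
  simp only [G] at hGe
  split_ifs at hGe with hn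
  · have h3 : ρ = max 0 (ρ - dist x y) := by linarith
    rcases max_choice 0 (ρ - dist x y) with h4 | h4
    · rw [h4] at h3; linarith
    · rw [h4] at h3
      have : dist x y = 0 := by linarith
      rw [dist_eq_zero.1 this, hn]
  · linarith

theorem eq_of_tensorDist_eq_zero (u v : Tensor X) (h : X.tensorDist u v = 0) : u = v := by
  obtain ⟨a, rfl⟩ := exists_rep u
  obtain ⟨b, rfl⟩ := exists_rep v
  by_cases ha : a.2 ∈ Set.range X.S
  · by_cases hb : b.2 ∈ Set.range X.S
    · obtain ⟨m, x⟩ := a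
      obtain ⟨n, y⟩ := b
      obtain ⟨p, hp⟩ := ha
      obtain ⟨q, hq⟩ := hb
      simp only at hp hq h ⊢
      subst hp hq
      have := taxicab_le_tensorDist (X := X) m n p q
      rw [h] at this
      have h1 := abs_nonneg ((NIndex.pos (m, p)).1 - (NIndex.pos (n, q)).1)
      have h2 := abs_nonneg ((NIndex.pos (m, p)).2 - (NIndex.pos (n, q)).2)
      have h3 := abs_eq_zero.1 (le_antisymm (by linarith) h1)
      have h4 := abs_eq_zero.1 (le_antisymm (by linarith) h2)
      exact tmul_eq_of_pos (Prod.ext (sub_eq_zero.1 h3) (sub_eq_zero.1 h4))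
    · rw [tensorDist_comm] at h
      rw [eq_of_tensorDist_eq_zero_of_notMem hb h]
  · rw [eq_of_tensorDist_eq_zero_of_notMem ha h]

instance (X : SquaMS.{u}) : MetricSpace (Tensor X) where
  dist := X.tensorDist
  dist_self := tensorDist_self
  dist_comm := tensorDist_comm
  dist_triangle := tensorDist_triangle
  eq_of_dist_eq_zero := eq_of_tensorDist_eq_zero _ _

theorem tensor_dist_def (u v : Tensor X) : dist u v = X.tensorDist u v := rfl

/-! ### `N ⊗ X` is a square metric space -/

/-- The boundary map of `N ⊗ X`: each side consists of three copies of the corresponding side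
of `X`. -/
def tensorS (X : SquaMS.{u}) (p : SquareBoundary) : Tensor X := tmul p.cell (X.S p.local')

/-- The boundary map of `N ⊗ X` may be computed in any cell that contains the point. -/
theorem tensorS_eq (p : SquareBoundary) (n : NIndex) (q : SquareBoundary)
    (h₁ : 3 * p.fst = ((n.1 : ℕ) : ℝ) + q.fst) (h₂ : 3 * p.snd = ((n.2 : ℕ) : ℝ) + q.snd) :
    X.tensorS p = tmul n (X.S q) := by
  refine tmul_eq_of_pos (Prod.ext ?_ ?_)
  · rw [NIndex.pos, NIndex.pos, ← h₁]
    exact add_sub_cancel _ _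
  · rw [NIndex.pos, NIndex.pos, ← h₂]
    exact add_sub_cancel _ _

theorem tensor_sq₂ (p q : SquareBoundary) :
    |p.fst - q.fst| + |p.snd - q.snd| ≤ dist (X.tensorS p) (X.tensorS q) := by
  have hpos : ∀ p : SquareBoundary, NIndex.pos (p.cell, p.local') = (3 * p.fst, 3 * p.snd) :=
    fun p => Prod.ext (add_sub_cancel _ _) (add_sub_cancel _ _)
  have := taxicab_le_tensorDist (X := X) p.cell q.cell p.local' q.local'
  rw [hpos, hpos] at this
  simp only [← mul_sub, abs_mul, abs_of_pos (by norm_num : (0 : ℝ) < 3)] at this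
  rw [tensor_dist_def, tensorS, tensorS]
  linarith

theorem short_of_thirds {T : Type*} [PseudoMetricSpace T] (φ : unitInterval → T)
    (h : ∀ (i : Fin 3) (r s r' s' : unitInterval), 3 * (r : ℝ) = ((i : ℕ) : ℝ) + r' →
      3 * (s : ℝ) = ((i : ℕ) : ℝ) + s' → dist (φ r) (φ s) ≤ |(s : ℝ) - r|)
    (r s : unitInterval) : dist (φ r) (φ s) ≤ |(s : ℝ) - r| := by
  have h' : ∀ (i : Fin 3) (r s : unitInterval), ((i : ℕ) : ℝ) ≤ 3 * r →
      (r : ℝ) ≤ s → 3 * (s : ℝ) ≤ ((i : ℕ) : ℝ) + 1 → dist (φ r) (φ s) ≤ s - r := by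
    intro i r s h1 h2 h3
    have := h i r s ⟨3 * r - ((i : ℕ) : ℝ), by constructor <;> linarith⟩
      ⟨3 * s - ((i : ℕ) : ℝ), by constructor <;> linarith⟩ (by simp) (by simp)
    rwa [abs_of_nonneg (by linarith)] at this
  have h0 := h' 0
  have h1 := h' 1
  have h2 := h' 2
  simp only [Fin.val_zero, Fin.val_one, Fin.val_two, Nat.cast_zero, Nat.cast_one,
    Nat.cast_ofNat] at h0 h1 h2
  obtain ⟨a, ha⟩ : ∃ a : unitInterval, (a : ℝ) = 1 / 3 := ⟨⟨1 / 3, by norm_num, by norm_num⟩, rfl⟩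
  obtain ⟨b, hb⟩ : ∃ b : unitInterval, (b : ℝ) = 2 / 3 := ⟨⟨2 / 3, by norm_num, by norm_num⟩, rfl⟩
  have k1 : ∀ r s : unitInterval, (r : ℝ) ≤ s → (s : ℝ) ≤ 2 / 3 → dist (φ r) (φ s) ≤ s - r := by
    intro r s hrs hs
    by_cases c1 : (s : ℝ) ≤ 1 / 3
    · exact h0 r s (by linarith [r.2.1]) hrs (by linarith)
    by_cases c2 : (1 : ℝ) / 3 ≤ r
    · exact h1 r s (by linarith) hrs (by linarith)
    have d1 := h0 r a (by linarith [r.2.1]) (by linarith) (by linarith)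
    have d2 := h1 a s (by linarith) (by linarith) (by linarith)
    linarith [dist_triangle (φ r) (φ a) (φ s)]
  have k2 : ∀ r s : unitInterval, (r : ℝ) ≤ s → dist (φ r) (φ s) ≤ s - r := by
    intro r s hrs
    by_cases c1 : (s : ℝ) ≤ 2 / 3
    · exact k1 r s hrs c1
    by_cases c2 : (2 : ℝ) / 3 ≤ r
    · exact h2 r s (by linarith) hrs (by linarith [s.2.2])
    have d1 := k1 r b (by linarith) (by linarith)
    have d2 := h2 b s (by linarith) (by linarith) (by linarith [s.2.2])
    linarith [dist_triangle (φ r) (φ b) (φ s)]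
  rcases le_total (r : ℝ) s with hrs | hrs
  · exact (k2 r s hrs).trans (le_abs_self _)
  · rw [dist_comm, abs_sub_comm]
    exact (k2 s r hrs).trans (le_abs_self _)

/-- The square metric space `N ⊗ X`. -/
def tensorObj (X : SquaMS.{u}) : SquaMS.{u} where
  carrier := Tensor X
  S := X.tensorS
  S_injective p q h := by
    have := tensor_sq₂ (X := X) p q
    rw [h, dist_self] at this
    have h1 := abs_nonneg (p.fst - q.fst)
    have h2 := abs_nonneg (p.snd - q.snd)
    exact SquareBoundary.ext'
      (sub_eq_zero.1 (abs_eq_zero.1 (le_antisymm (by linarith) h1)))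
      (sub_eq_zero.1 (abs_eq_zero.1 (le_antisymm (by linarith) h2)))
  bounded u v := by
    obtain ⟨a, rfl⟩ := exists_rep u
    obtain ⟨b, rfl⟩ := exists_rep v
    exact (tensorDist_le_copyDist a b).trans (copyDist_le_two a b)
  sq₁_left r s := by
    refine le_antisymm ?_ ?_
    · refine short_of_thirds (fun r => X.tensorS (SquareBoundary.left r)) ?_ r s
      intro i r s r' s' hr hs
      rw [tensorS_eq (.left r) (0, i) (.left r') (by simp [SquareBoundary.left,
        SquareBoundary.fst]) hr, tensorS_eq (.left s) (0, i) (.left s') (by simp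
        [SquareBoundary.left, SquareBoundary.fst]) hs]
      refine (tensorDist_same _ _ _).trans ?_
      rw [X.sq₁_left, show (s' : ℝ) - r' = 3 * (s - r) by linarith, abs_mul,
        abs_of_pos (by norm_num : (0 : ℝ) < 3)]
      linarith
    · refine le_trans ?_ (tensor_sq₂ _ _)
      simp [SquareBoundary.left, SquareBoundary.fst, SquareBoundary.snd, abs_sub_comm]
  sq₁_right r s := by
    refine le_antisymm ?_ ?_
    · refine short_of_thirds (fun r => X.tensorS (SquareBoundary.right r)) ?_ r s
      intro i r s r' s' hr hs
      rw [tensorS_eq (.right r) (2, i) (.right r') (by norm_num [SquareBoundary.right,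
        SquareBoundary.fst]) hr, tensorS_eq (.right s) (2, i) (.right s') (by norm_num
        [SquareBoundary.right, SquareBoundary.fst]) hs]
      refine (tensorDist_same _ _ _).trans ?_
      rw [X.sq₁_right, show (s' : ℝ) - r' = 3 * (s - r) by linarith, abs_mul,
        abs_of_pos (by norm_num : (0 : ℝ) < 3)]
      linarith
    · refine le_trans ?_ (tensor_sq₂ _ _)
      simp [SquareBoundary.right, SquareBoundary.fst, SquareBoundary.snd, abs_sub_comm]
  sq₁_bottom r s := by
    refine le_antisymm ?_ ?_
    · refine short_of_thirds (fun r => X.tensorS (SquareBoundary.bottom r)) ?_ r s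
      intro i r s r' s' hr hs
      rw [tensorS_eq (.bottom r) (i, 0) (.bottom r') hr (by simp [SquareBoundary.bottom,
        SquareBoundary.snd]), tensorS_eq (.bottom s) (i, 0) (.bottom s') hs (by simp
        [SquareBoundary.bottom, SquareBoundary.snd])]
      refine (tensorDist_same _ _ _).trans ?_
      rw [X.sq₁_bottom, show (s' : ℝ) - r' = 3 * (s - r) by linarith, abs_mul,
        abs_of_pos (by norm_num : (0 : ℝ) < 3)]
      linarith
    · refine le_trans ?_ (tensor_sq₂ _ _)
      simp [SquareBoundary.bottom, SquareBoundary.fst, SquareBoundary.snd, abs_sub_comm]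
  sq₁_top r s := by
    refine le_antisymm ?_ ?_
    · refine short_of_thirds (fun r => X.tensorS (SquareBoundary.top r)) ?_ r s
      intro i r s r' s' hr hs
      rw [tensorS_eq (.top r) (i, 2) (.top r') hr (by norm_num [SquareBoundary.top,
        SquareBoundary.snd]), tensorS_eq (.top s) (i, 2) (.top s') hs (by norm_num
        [SquareBoundary.top, SquareBoundary.snd])]
      refine (tensorDist_same _ _ _).trans ?_
      rw [X.sq₁_top, show (s' : ℝ) - r' = 3 * (s - r) by linarith, abs_mul,
        abs_of_pos (by norm_num : (0 : ℝ) < 3)]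
      linarith
    · refine le_trans ?_ (tensor_sq₂ _ _)
      simp [SquareBoundary.top, SquareBoundary.fst, SquareBoundary.snd, abs_sub_comm]
  sq₂ := tensor_sq₂

/-- The morphism `N ⊗ f` of square metric spaces. -/
def tensorHom (f : X ⟶ Y) : tensorObj X ⟶ tensorObj Y where
  toFun := tensorMap f.toSetHom
  map_S p := by
    change (tmul p.cell (f.toFun (X.S p.local')) : Tensor Y) = tmul p.cell (Y.S p.local')
    rw [f.map_S]
  short := dist_le_tensorDist (tensorMap f.toSetHom) fun a b => by
    refine (tensorDist_le_copyDist (a.1, f.toFun a.2) (b.1, f.toFun b.2)).trans ?_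
    unfold copyDist
    dsimp only
    split_ifs
    · linarith [f.short a.2 b.2]
    · exact le_rfl

/-- The functor `N ⊗ -` on square metric spaces. -/
def tensorN : SquaMS.{u} ⥤ SquaMS.{u} where
  obj := tensorObj
  map := tensorHom
  map_id X := by
    refine Hom.ext (funext fun u => ?_)
    obtain ⟨a, rfl⟩ := exists_rep u
    rfl
  map_comp f g := by
    refine Hom.ext (funext fun u => ?_)
    obtain ⟨a, rfl⟩ := exists_rep u
    rfl

end SquaMS

/-! ### The unit square -/

/-- The points of the unit square `[0,1]²`, in any universe. -/
@[ext]
structure UnitSquare : Type u where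
  x : unitInterval
  y : unitInterval

namespace UnitSquare

/-- The taxicab metric. -/
instance : MetricSpace UnitSquare.{u} where
  dist z w := |(z.x : ℝ) - w.x| + |(z.y : ℝ) - w.y|
  dist_self z := by simp
  dist_comm z w := by rw [abs_sub_comm (z.x : ℝ), abs_sub_comm (z.y : ℝ)]
  dist_triangle z w v := by
    have h1 := abs_sub_le (z.x : ℝ) w.x v.x
    have h2 := abs_sub_le (z.y : ℝ) w.y v.y
    linarith
  eq_of_dist_eq_zero {z w} h := by
    have h1 := abs_nonneg ((z.x : ℝ) - w.x)
    have h2 := abs_nonneg ((z.y : ℝ) - w.y)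
    exact UnitSquare.ext
      (Subtype.ext (sub_eq_zero.1 (abs_eq_zero.1 (le_antisymm (by linarith) h1))))
      (Subtype.ext (sub_eq_zero.1 (abs_eq_zero.1 (le_antisymm (by linarith) h2))))

theorem dist_def (z w : UnitSquare.{u}) :
    dist z w = |(z.x : ℝ) - w.x| + |(z.y : ℝ) - w.y| := rfl

theorem third_mem (i : Fin 3) (t : unitInterval) :
    0 ≤ ((i : ℕ) : ℝ) / 3 + 1 / 3 * (t : ℝ) ∧ ((i : ℕ) : ℝ) / 3 + 1 / 3 * (t : ℝ) ≤ 1 := by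
  have h0 := t.2.1
  have h1 := t.2.2
  fin_cases i <;> norm_num <;> constructor <;> linarith

/-- The point `shrink n + z / 3`, where `shrink (i, j) = (i / 3, j / 3)`. -/
def shrinkAdd (n : NIndex) (z : UnitSquare.{u}) : UnitSquare.{u} :=
  ⟨⟨((n.1 : ℕ) : ℝ) / 3 + 1 / 3 * (z.x : ℝ), third_mem n.1 z.x⟩,
    ⟨((n.2 : ℕ) : ℝ) / 3 + 1 / 3 * (z.y : ℝ), third_mem n.2 z.y⟩⟩

end UnitSquare

namespace SquaMS

/-- The unit square `U₀ = [0,1]²` with the taxicab metric and the inclusion of its boundary. -/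
def U₀ : SquaMS.{u} where
  carrier := UnitSquare.{u}
  S p := ⟨p.1.1, p.1.2⟩
  S_injective p q h := by
    obtain ⟨h1, h2⟩ := UnitSquare.mk.inj h
    exact Subtype.ext (Prod.ext h1 h2)
  bounded z w := by
    have h1 := z.x.2
    have h2 := z.y.2
    have h3 := w.x.2
    have h4 := w.y.2
    have h5 : |(z.x : ℝ) - w.x| ≤ 1 := abs_le.2 ⟨by linarith [h1.1, h3.2], by linarith [h1.2, h3.1]⟩
    have h6 : |(z.y : ℝ) - w.y| ≤ 1 := abs_le.2 ⟨by linarith [h2.1, h4.2], by linarith [h2.2, h4.1]⟩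
    rw [UnitSquare.dist_def]
    linarith
  sq₁_left r s := by simp [UnitSquare.dist_def, SquareBoundary.left, abs_sub_comm]
  sq₁_right r s := by simp [UnitSquare.dist_def, SquareBoundary.right, abs_sub_comm]
  sq₁_bottom r s := by simp [UnitSquare.dist_def, SquareBoundary.bottom, abs_sub_comm]
  sq₁_top r s := by simp [UnitSquare.dist_def, SquareBoundary.top, abs_sub_comm]
  sq₂ p q := le_rfl

/-- The function `n ⊗ z ↦ shrink n + z / 3` on `N ⊗ U₀`. -/
def alphaFun : Tensor U₀.{u} → UnitSquare.{u} :=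
  tensorLift (X := U₀.{u}) (fun a => UnitSquare.shrinkAdd a.1 a.2) (by
    rintro ⟨m, x⟩ ⟨n, y⟩ ⟨p, q, h, hx, hy⟩
    simp only at h hx hy
    subst hx hy
    obtain ⟨e1, e2⟩ := Prod.ext_iff.1 h.pos_eq
    simp only [NIndex.pos, SquareBoundary.fst, SquareBoundary.snd] at e1 e2
    refine UnitSquare.ext (Subtype.ext ?_) (Subtype.ext ?_)
    · change ((m.1 : ℕ) : ℝ) / 3 + 1 / 3 * (p.1.1 : ℝ) = ((n.1 : ℕ) : ℝ) / 3 + 1 / 3 * (q.1.1 : ℝ)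
      linarith
    · change ((m.2 : ℕ) : ℝ) / 3 + 1 / 3 * (p.1.2 : ℝ) = ((n.2 : ℕ) : ℝ) / 3 + 1 / 3 * (q.1.2 : ℝ)
      linarith)

/-- The algebra structure `α_N : N ⊗ U₀ ⟶ U₀`, `n ⊗ z ↦ shrink n + z / 3`. -/
def alphaN : tensorN.obj U₀.{u} ⟶ U₀.{u} where
  toFun := alphaFun
  map_S p := by
    refine UnitSquare.ext (Subtype.ext ?_) (Subtype.ext ?_)
    · change ((SquareBoundary.digit p.fst : ℕ) : ℝ) / 3 +
        1 / 3 * (3 * p.fst - ((SquareBoundary.digit p.fst : ℕ) : ℝ)) = p.fst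
      ring
    · change ((SquareBoundary.digit p.snd : ℕ) : ℝ) / 3 +
        1 / 3 * (3 * p.snd - ((SquareBoundary.digit p.snd : ℕ) : ℝ)) = p.snd
      ring
  short := dist_le_tensorDist (X := U₀.{u}) alphaFun fun a b => by
    unfold copyDist
    split_ifs with h
    · obtain ⟨m, z⟩ := a
      obtain ⟨n, w⟩ := b
      simp only at h
      subst h
      refine le_of_eq ?_
      change |((m.1 : ℕ) : ℝ) / 3 + 1 / 3 * (z.x : ℝ) - (((m.1 : ℕ) : ℝ) / 3 + 1 / 3 * (w.x : ℝ))| +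
        |((m.2 : ℕ) : ℝ) / 3 + 1 / 3 * (z.y : ℝ) - (((m.2 : ℕ) : ℝ) / 3 + 1 / 3 * (w.y : ℝ))| =
        (|(z.x : ℝ) - w.x| + |(z.y : ℝ) - w.y|) / 3
      rw [add_sub_add_left_eq_sub, add_sub_add_left_eq_sub, ← mul_sub, ← mul_sub, abs_mul, abs_mul,
        abs_of_pos (by norm_num : (0 : ℝ) < 1 / 3)]
      ring
    · exact U₀.bounded _ _

end SquaMS

/-- An algebra `(A, a)` of an endofunctor `F` is corecursive if for every coalgebra `(E, e)` there
is a unique morphism `f : E ⟶ A` with `f = a ∘ F f ∘ e`. -/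
def IsCorecursiveAlgebra {C : Type*} [Category C] {F : C ⥤ C} (A : Endofunctor.Algebra F) : Prop :=
  ∀ E : Endofunctor.Coalgebra F, ∃! f : E.V ⟶ A.a, f = E.str ≫ F.map f ≫ A.str

end

/-!
A morphism `a : N ⊗ A ⟶ A` is short while each copy of `A` in `N ⊗ A` is scaled by `1/3`, so
`f ↦ a ∘ (N ⊗ f) ∘ β` contracts the uniform distance on functions `B → A` by `1/3`. Hence solutions
are unique. If `A` is complete, the short maps of square sets form a complete invariant set, and
Banach's theorem produces a short solution as soon as there is one short map of square sets `B → A`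
to start from. For `A = U₀` such a map exists: in the rotated coordinates `x + y`, `x - y` the
taxicab metric is the supremum metric, so real-valued Lipschitz extension applies to each of them.

A corecursive algebra with invertible structure map is a final coalgebra. The structure map `α_N` is
invertible because it is a surjective isometry: its inverse is short on each of the nine cells,
hence on horizontal and vertical segments, and two such segments realise a taxicab distance.
-/

theorem exists_taxicab_extension {X : Type*} [PseudoMetricSpace X] {s : Set X} {f₁ f₂ : X → ℝ}
    (hf : ∀ x ∈ s, ∀ y ∈ s, |f₁ x - f₁ y| + |f₂ x - f₂ y| ≤ dist x y) :
    ∃ g₁ g₂ : X → ℝ, Set.EqOn g₁ f₁ s ∧ Set.EqOn g₂ f₂ s ∧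
      ∀ x y, |g₁ x - g₁ y| + |g₂ x - g₂ y| ≤ dist x y := by
  have lipschitz_add : LipschitzOnWith 1 (fun x => f₁ x + f₂ x) s :=
    LipschitzOnWith.of_dist_le_mul fun x hx y hy => by
      rw [Real.dist_eq, add_sub_add_comm, NNReal.coe_one, one_mul]
      exact (abs_add_le _ _).trans (hf x hx y hy)
  have lipschitz_sub : LipschitzOnWith 1 (fun x => f₁ x - f₂ x) s :=
    LipschitzOnWith.of_dist_le_mul fun x hx y hy => by
      rw [Real.dist_eq, sub_sub_sub_comm, NNReal.coe_one, one_mul]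
      exact (abs_sub _ _).trans (hf x hx y hy)
  obtain ⟨p, hp, hpf⟩ := lipschitz_add.extend_real
  obtain ⟨q, hq, hqf⟩ := lipschitz_sub.extend_real
  refine ⟨fun x => (p x + q x) / 2, fun x => (p x - q x) / 2, fun x hx => ?_, fun x hx => ?_,
    fun x y => ?_⟩
  · linarith [hpf hx, hqf hx]
  · linarith [hpf hx, hqf hx]
  · have hpxy : |p x - p y| ≤ dist x y := by simpa [Real.dist_eq] using hp.dist_le_mul x y
    have hqxy : |q x - q y| ≤ dist x y := by simpa [Real.dist_eq] using hq.dist_le_mul x y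
    calc |(p x + q x) / 2 - (p y + q y) / 2| + |(p x - q x) / 2 - (p y - q y) / 2|
        = max |p x - p y| |q x - q y| := by grind
      _ ≤ dist x y := max_le hpxy hqxy

section GuardedRecursion

open scoped UniformConvergence NNReal

variable {ι A B : Type*}

/-- The operator whose fixed points are the solutions `f : B → A` of the recursive equation
`f b = c i (f x)` for `σ b = (i, x)`. It acts on the type synonym `B →ᵤ A` of `B → A`, which carries
the uniform distance. -/
def recursionOperator (c : ι → A → A) (σ : B → ι × B) (f : B →ᵤ A) : B →ᵤ A :=
  UniformFun.ofFun fun b => c (σ b).1 (UniformFun.toFun f (σ b).2)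

theorem contractingWith_recursionOperator [EMetricSpace A] {K : ℝ≥0} (hK : K < 1)
    {c : ι → A → A} (hc : ∀ i, LipschitzWith K (c i)) (σ : B → ι × B) :
    ContractingWith K (recursionOperator c σ) :=
  ⟨hK, UniformFun.lipschitzWith_ofFun_iff.2 fun b => by
    have h := (hc (σ b).1).comp (UniformFun.lipschitzWith_eval (σ b).2)
    rwa [mul_one] at h⟩

variable [MetricSpace A] [BoundedSpace A] {K : ℝ≥0} {c : ι → A → A} {σ : B → ι × B}

theorem eq_of_forall_eq_of_lipschitzWith (hK : K < 1) (hc : ∀ i, LipschitzWith K (c i))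
    {f g : B → A} (hf : ∀ b, f b = c (σ b).1 (f (σ b).2))
    (hg : ∀ b, g b = c (σ b).1 (g (σ b).2)) : f = g :=
  (contractingWith_recursionOperator hK hc σ).fixedPoint_unique'
    (x := UniformFun.ofFun f) (y := UniformFun.ofFun g) (funext hf).symm (funext hg).symm

theorem exists_mem_forall_eq_of_lipschitzWith [CompleteSpace A] (hK : K < 1)
    (hc : ∀ i, LipschitzWith K (c i)) {C : Set (B → A)} (hC : IsClosed C) (hne : C.Nonempty)
    (hmaps : ∀ f ∈ C, (fun b => c (σ b).1 (f (σ b).2)) ∈ C) :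
    ∃ f ∈ C, ∀ b, f b = c (σ b).1 (f (σ b).2) := by
  have complete : IsComplete (UniformFun.toFun ⁻¹' C : Set (B →ᵤ A)) :=
    (hC.preimage UniformFun.uniformContinuous_toFun.continuous).isComplete
  have invariant : Set.MapsTo (recursionOperator c σ) (UniformFun.toFun ⁻¹' C)
      (UniformFun.toFun ⁻¹' C) := fun f hf => hmaps (UniformFun.toFun f) hf
  obtain ⟨f₀, hf₀⟩ := hne
  obtain ⟨f, hfC, hf, -⟩ := ContractingWith.exists_fixedPoint' complete invariant
    ((contractingWith_recursionOperator hK hc σ).restrict invariant)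
    (x := UniformFun.ofFun f₀) hf₀ (edist_ne_top _ _)
  exact ⟨UniformFun.toFun f, hfC, fun b => (congrFun hf b).symm⟩

end GuardedRecursion

theorem IsCorecursiveAlgebra.nonempty_isTerminal {C : Type*} [Category C] {F : C ⥤ C}
    {A : Endofunctor.Algebra F} (hA : IsCorecursiveAlgebra A) [IsIso A.str] :
    Nonempty (Limits.IsTerminal (⟨A.a, inv A.str⟩ : Endofunctor.Coalgebra F)) := by
  have hom_iff (E : Endofunctor.Coalgebra F) (f : E.V ⟶ A.a) :
      E.str ≫ F.map f = f ≫ inv A.str ↔ f = E.str ≫ F.map f ≫ A.str := by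
    rw [IsIso.eq_comp_inv, Category.assoc, eq_comm]
  choose f hf hf_unique using hA
  exact ⟨Limits.IsTerminal.ofUniqueHom (fun E => ⟨f E, (hom_iff E _).2 (hf E)⟩)
    fun E g => Endofunctor.Coalgebra.Hom.ext (hf_unique E g.f ((hom_iff E _).1 g.h))⟩

namespace SquaMS

instance (X : SquaMS.{u}) : BoundedSpace X :=
  Metric.boundedSpace_iff.2 ⟨2, X.bounded⟩

theorem isClosed_range_toFun (X Y : SquaMS.{u}) :
    IsClosed (Set.range fun f : X ⟶ Y => f.toFun) := by
  have range_eq : (Set.range fun f : X ⟶ Y => f.toFun) =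
      {f | (∀ p, f (X.S p) = Y.S p) ∧ ∀ x y, dist (f x) (f y) ≤ dist x y} :=
    Set.Subset.antisymm (Set.range_subset_iff.2 fun f => ⟨f.map_S, f.short⟩)
      fun f hf => ⟨⟨⟨f, hf.1⟩, hf.2⟩, rfl⟩
  rw [range_eq]
  simp only [Set.ofPred_and, Set.ofPred_forall]
  exact (isClosed_iInter fun p => isClosed_eq (continuous_apply _) continuous_const).inter
    (isClosed_iInter fun x => isClosed_iInter fun y =>
      isClosed_le ((continuous_apply x).dist (continuous_apply y)) continuous_const)

theorem isIso_of_isometry_of_surjective {X Y : SquaMS.{u}} (f : X ⟶ Y) (hf : Isometry f.toFun)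
    (hsurj : Function.Surjective f.toFun) : IsIso f := by
  have right_inv := Function.rightInverse_surjInv hsurj
  have left_inv : Function.LeftInverse (Function.surjInv hsurj) f.toFun :=
    Function.leftInverse_surjInv ⟨hf.injective, hsurj⟩
  let g : Y ⟶ X :=
    { toFun := Function.surjInv hsurj
      map_S p := by rw [← f.map_S p, left_inv]
      short x y := by rw [← hf.dist_eq, right_inv, right_inv] }
  exact ⟨g, Hom.ext left_inv.comp_eq_id, Hom.ext right_inv.comp_eq_id⟩

section Solutions

variable {A B : SquaMS.{u}}

theorem lipschitzWith_toFun_tmul (a : tensorN.obj A ⟶ A) (n : NIndex) :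
    LipschitzWith 3⁻¹ fun x : A => a.toFun (tmul n x) :=
  LipschitzWith.of_dist_le_mul fun x y =>
    calc dist (a.toFun (tmul n x)) (a.toFun (tmul n y))
        ≤ A.tensorDist (tmul n x) (tmul n y) := a.short _ _
      _ ≤ dist x y / 3 := tensorDist_same n x y
      _ = (3⁻¹ : NNReal) * dist x y := by push_cast; ring

/-- A map of square sets `f : B → A`, not required to be short, with `f = a ∘ (N ⊗ f) ∘ β`. -/
def IsSolution (β : B ⟶ tensorN.obj B) (a : tensorN.obj A ⟶ A) (f : SetHom B A) : Prop :=
  ∀ b, f.toFun b = a.toFun (tensorMap f (β.toFun b))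

variable {β : B ⟶ tensorN.obj B} {a : tensorN.obj A ⟶ A}

theorem isSolution_toSetHom_iff {f : B ⟶ A} :
    IsSolution β a f.toSetHom ↔ f = β ≫ tensorN.map f ≫ a :=
  ⟨fun h => Hom.ext (funext h), fun h b => congrFun (congrArg (fun g : Hom B A => g.toFun) h) b⟩

theorem toFun_tensorMap_eq_out (a : tensorN.obj A ⟶ A) (f : SetHom B A) (u : Tensor B) :
    a.toFun (tensorMap f u) = a.toFun (tmul (Quotient.out u).1 (f.toFun (Quotient.out u).2)) := by
  conv_lhs => rw [← Quotient.out_eq u]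
  rfl

theorem IsSolution.eq {f g : SetHom B A} (hf : IsSolution β a f) (hg : IsSolution β a g) :
    f = g :=
  SetHom.ext <| eq_of_forall_eq_of_lipschitzWith (σ := fun b => Quotient.out (β.toFun b))
    (by norm_num) (lipschitzWith_toFun_tmul a)
    (fun b => (hf b).trans (toFun_tensorMap_eq_out a f _))
    (fun b => (hg b).trans (toFun_tensorMap_eq_out a g _))

theorem exists_hom_isSolution [CompleteSpace A] (β : B ⟶ tensorN.obj B) (a : tensorN.obj A ⟶ A)
    (h : Nonempty (B ⟶ A)) : ∃ f : B ⟶ A, IsSolution β a f.toSetHom := by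
  obtain ⟨f₀⟩ := h
  obtain ⟨_, ⟨f, rfl⟩, hf⟩ := exists_mem_forall_eq_of_lipschitzWith
    (σ := fun b => Quotient.out (β.toFun b)) (K := 3⁻¹) (by norm_num) (lipschitzWith_toFun_tmul a)
    (isClosed_range_toFun B A) ⟨f₀.toFun, f₀, rfl⟩ (by
      rintro _ ⟨f, rfl⟩
      exact ⟨β ≫ tensorN.map f ≫ a, funext fun b => toFun_tensorMap_eq_out a f.toSetHom _⟩)
  exact ⟨f, fun b => (hf b).trans (toFun_tensorMap_eq_out a f.toSetHom _).symm⟩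

theorem isCorecursiveAlgebra_of_completeSpace (A : Endofunctor.Algebra tensorN.{u})
    [CompleteSpace A.a] (h : ∀ X : SquaMS.{u}, Nonempty (X ⟶ A.a)) : IsCorecursiveAlgebra A := by
  intro E
  obtain ⟨f, hf⟩ := exists_hom_isSolution E.str A.str (h E.V)
  refine ⟨f, isSolution_toSetHom_iff.1 hf, fun g hg => ?_⟩
  exact Hom.ext (congrArg SetHom.toFun ((isSolution_toSetHom_iff.2 hg).eq hf))

end Solutions

end SquaMS

namespace UnitSquare

instance : CompactSpace UnitSquare.{u} := by
  let e : unitInterval × unitInterval → UnitSquare.{u} := fun p => ⟨p.1, p.2⟩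
  have he : LipschitzWith 2 e := LipschitzWith.of_dist_le_mul fun p q => by
    have h₁ : |(p.1 : ℝ) - q.1| ≤ dist p q := le_max_left _ _
    have h₂ : |(p.2 : ℝ) - q.2| ≤ dist p q := le_max_right _ _
    calc dist (e p) (e q) = |(p.1 : ℝ) - q.1| + |(p.2 : ℝ) - q.2| := rfl
      _ ≤ 2 * dist p q := by linarith
  have he_surj : Function.Surjective e := fun z => ⟨(z.x, z.y), rfl⟩
  exact he_surj.compactSpace he.continuous

theorem eq_shrinkAdd_iff {z w : UnitSquare.{u}} {n : NIndex} :
    z = shrinkAdd n w ↔ 3 * (z.x : ℝ) = ((n.1 : ℕ) : ℝ) + w.x ∧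
      3 * (z.y : ℝ) = ((n.2 : ℕ) : ℝ) + w.y := by
  rw [UnitSquare.ext_iff, Subtype.ext_iff, Subtype.ext_iff]
  simp only [shrinkAdd]
  constructor <;> rintro ⟨hx, hy⟩ <;> constructor <;> linarith

theorem dist_shrinkAdd (n : NIndex) (z w : UnitSquare.{u}) :
    dist (shrinkAdd n z) (shrinkAdd n w) = dist z w / 3 := by
  simp only [dist_def, shrinkAdd, add_sub_add_left_eq_sub, ← mul_sub, abs_mul,
    abs_of_pos (one_div_pos.2 (zero_lt_three (α := ℝ)))]
  ring

/-- The index of a cell of the `3 × 3` grid that contains `z`. -/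
noncomputable def cell (z : UnitSquare.{u}) : NIndex :=
  (SquareBoundary.digit z.x, SquareBoundary.digit z.y)

/-- The position of `z` in the cell `z.cell`, after rescaling by `3`. -/
noncomputable def localPoint (z : UnitSquare.{u}) : UnitSquare.{u} :=
  ⟨⟨_, SquareBoundary.digit_spec z.x.2⟩, ⟨_, SquareBoundary.digit_spec z.y.2⟩⟩

theorem shrinkAdd_cell_localPoint (z : UnitSquare.{u}) : shrinkAdd z.cell z.localPoint = z :=
  (eq_shrinkAdd_iff.2 ⟨(add_sub_cancel _ _).symm, (add_sub_cancel _ _).symm⟩).symm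

end UnitSquare

namespace SquaMS

open UnitSquare

theorem nonempty_hom_U₀ (X : SquaMS.{u}) : Nonempty (X ⟶ U₀.{u}) := by
  have extend_apply (f : SquareBoundary → ℝ) (p) : Function.extend X.S f 0 (X.S p) = f p :=
    X.S_injective.extend_apply f 0 p
  obtain ⟨g₁, g₂, hg₁, hg₂, hg⟩ := exists_taxicab_extension (s := Set.range X.S)
    (f₁ := Function.extend X.S SquareBoundary.fst 0)
    (f₂ := Function.extend X.S SquareBoundary.snd 0) (by
      rintro _ ⟨p, rfl⟩ _ ⟨q, rfl⟩
      simpa only [extend_apply] using X.sq₂ p q)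
  let clamp : ℝ → unitInterval := Set.projIcc 0 1 zero_le_one
  have clamp_short (s t : ℝ) : |(clamp s : ℝ) - clamp t| ≤ |s - t| := by
    simpa [Subtype.dist_eq, Real.dist_eq] using
      (LipschitzWith.projIcc (zero_le_one (α := ℝ))).dist_le_mul s t
  refine ⟨⟨⟨fun x => ⟨clamp (g₁ x), clamp (g₂ x)⟩, fun p => UnitSquare.ext ?_ ?_⟩, fun x y => ?_⟩⟩
  · rw [hg₁ ⟨p, rfl⟩, extend_apply]
    exact Set.projIcc_val zero_le_one p.1.1
  · rw [hg₂ ⟨p, rfl⟩, extend_apply]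
    exact Set.projIcc_val zero_le_one p.1.2
  · exact (add_le_add (clamp_short _ _) (clamp_short _ _)).trans (hg x y)

theorem mem_range_U₀_S {z : UnitSquare.{u}}
    (hz : ((z.x : ℝ) = 0 ∨ (z.x : ℝ) = 1) ∨ (z.y : ℝ) = 0 ∨ (z.y : ℝ) = 1) :
    z ∈ Set.range U₀.{u}.S :=
  ⟨SquareBoundary.mk' z.x z.y z.x.2 z.y.2 (or_assoc.1 hz), rfl⟩

theorem tmul_eq_of_shrinkAdd_eq {m n : NIndex} {z w : UnitSquare.{u}}
    (h : shrinkAdd m z = shrinkAdd n w) : (tmul m z : Tensor U₀.{u}) = tmul n w := by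
  obtain ⟨hmx, hmy⟩ := eq_shrinkAdd_iff.1 (Eq.refl (shrinkAdd m z))
  obtain ⟨hnx, hny⟩ := eq_shrinkAdd_iff.1 h
  have hx : ((m.1 : ℕ) : ℝ) + z.x = ((n.1 : ℕ) : ℝ) + w.x := hmx.symm.trans hnx
  have hy : ((m.2 : ℕ) : ℝ) + z.y = ((n.2 : ℕ) : ℝ) + w.y := hmy.symm.trans hny
  have tmul_eq_of_boundary (hz : z ∈ Set.range U₀.{u}.S) (hw : w ∈ Set.range U₀.{u}.S) :
      (tmul m z : Tensor U₀.{u}) = tmul n w := by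
    obtain ⟨p, rfl⟩ := hz
    obtain ⟨q, rfl⟩ := hw
    exact tmul_eq_of_pos (Prod.ext hx hy)
  obtain ⟨i, j⟩ := m
  obtain ⟨k, l⟩ := n
  rcases NIndex.coord_cases i k z.x.2 w.x.2 hx with ⟨rfl, hzwx⟩ | ⟨_, -, -, hz, hw⟩ |
    ⟨_, -, -, hw, hz⟩
  · rcases NIndex.coord_cases j l z.y.2 w.y.2 hy with ⟨rfl, hzwy⟩ | ⟨_, -, -, hz, hw⟩ |
      ⟨_, -, -, hw, hz⟩
    · obtain rfl : z = w := UnitSquare.ext (Subtype.ext hzwx) (Subtype.ext hzwy)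
      rfl
    all_goals exact tmul_eq_of_boundary (mem_range_U₀_S (by tauto)) (mem_range_U₀_S (by tauto))
  all_goals exact tmul_eq_of_boundary (mem_range_U₀_S (by tauto)) (mem_range_U₀_S (by tauto))

/-- The inverse of `alphaFun`, computed in one chosen cell containing the point. -/
noncomputable def subdivide (z : UnitSquare.{u}) : Tensor U₀.{u} := tmul z.cell z.localPoint

theorem alphaFun_subdivide (z : UnitSquare.{u}) : alphaFun (subdivide z) = z :=
  shrinkAdd_cell_localPoint z

theorem subdivide_shrinkAdd (n : NIndex) (z : UnitSquare.{u}) :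
    subdivide (shrinkAdd n z) = tmul n z :=
  tmul_eq_of_shrinkAdd_eq (shrinkAdd_cell_localPoint _)

theorem subdivide_alphaFun (v : Tensor U₀.{u}) : subdivide (alphaFun v) = v := by
  obtain ⟨⟨n, z⟩, rfl⟩ := exists_rep v
  exact subdivide_shrinkAdd n z

theorem dist_subdivide_shrinkAdd_le (n : NIndex) (z w : UnitSquare.{u}) :
    dist (subdivide (shrinkAdd n z)) (subdivide (shrinkAdd n w)) ≤
      dist (shrinkAdd n z) (shrinkAdd n w) := by
  rw [subdivide_shrinkAdd, subdivide_shrinkAdd, dist_shrinkAdd]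
  exact tensorDist_same n _ _

theorem exists_three_mul_eq_add (t : unitInterval) :
    ∃ (j : Fin 3) (t' : unitInterval), 3 * (t : ℝ) = ((j : ℕ) : ℝ) + t' :=
  ⟨_, ⟨_, SquareBoundary.digit_spec t.2⟩, (add_sub_cancel _ _).symm⟩

theorem dist_subdivide_horizontal_le (r s t : unitInterval) :
    dist (subdivide.{u} ⟨r, t⟩) (subdivide ⟨s, t⟩) ≤ |(s : ℝ) - r| := by
  refine short_of_thirds (fun r => subdivide.{u} ⟨r, t⟩) (fun i r s r' s' hr hs => ?_) r s
  obtain ⟨j, t', ht⟩ := exists_three_mul_eq_add t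
  have r_eq := eq_shrinkAdd_iff (z := ⟨r, t⟩) (n := (i, j)) (w := ⟨r', t'⟩).2 ⟨hr, ht⟩
  have s_eq := eq_shrinkAdd_iff (z := ⟨s, t⟩) (n := (i, j)) (w := ⟨s', t'⟩).2 ⟨hs, ht⟩
  calc dist (subdivide.{u} ⟨r, t⟩) (subdivide ⟨s, t⟩)
      ≤ dist (⟨r, t⟩ : UnitSquare.{u}) ⟨s, t⟩ := by
        rw [r_eq, s_eq]
        exact dist_subdivide_shrinkAdd_le _ _ _
    _ = |(s : ℝ) - r| := by simp [dist_def, abs_sub_comm]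

theorem dist_subdivide_vertical_le (t r s : unitInterval) :
    dist (subdivide.{u} ⟨t, r⟩) (subdivide ⟨t, s⟩) ≤ |(s : ℝ) - r| := by
  refine short_of_thirds (fun r => subdivide.{u} ⟨t, r⟩) (fun i r s r' s' hr hs => ?_) r s
  obtain ⟨j, t', ht⟩ := exists_three_mul_eq_add t
  have r_eq := eq_shrinkAdd_iff (z := ⟨t, r⟩) (n := (j, i)) (w := ⟨t', r'⟩).2 ⟨ht, hr⟩
  have s_eq := eq_shrinkAdd_iff (z := ⟨t, s⟩) (n := (j, i)) (w := ⟨t', s'⟩).2 ⟨ht, hs⟩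
  calc dist (subdivide.{u} ⟨t, r⟩) (subdivide ⟨t, s⟩)
      ≤ dist (⟨t, r⟩ : UnitSquare.{u}) ⟨t, s⟩ := by
        rw [r_eq, s_eq]
        exact dist_subdivide_shrinkAdd_le _ _ _
    _ = |(s : ℝ) - r| := by simp [dist_def, abs_sub_comm]

theorem dist_subdivide_le (z w : UnitSquare.{u}) :
    dist (subdivide z) (subdivide w) ≤ dist z w :=
  calc dist (subdivide z) (subdivide w)
      ≤ dist (subdivide z) (subdivide ⟨w.x, z.y⟩) + dist (subdivide ⟨w.x, z.y⟩) (subdivide w) :=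
        dist_triangle _ _ _
    _ ≤ |(w.x : ℝ) - z.x| + |(w.y : ℝ) - z.y| :=
        add_le_add (dist_subdivide_horizontal_le _ _ _) (dist_subdivide_vertical_le _ _ _)
    _ = dist z w := by rw [dist_def, abs_sub_comm (z.x : ℝ), abs_sub_comm (z.y : ℝ)]

theorem isometry_alphaN : Isometry alphaN.{u}.toFun :=
  Isometry.of_dist_eq fun v w => le_antisymm (alphaN.short v w) <|
    calc dist v w = dist (subdivide (alphaFun v)) (subdivide (alphaFun w)) :=
          (congrArg₂ dist (subdivide_alphaFun v) (subdivide_alphaFun w)).symm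
      _ ≤ dist (alphaFun v) (alphaFun w) := dist_subdivide_le _ _

instance : IsIso alphaN.{u} :=
  isIso_of_isometry_of_surjective alphaN isometry_alphaN fun z =>
    ⟨subdivide z, alphaFun_subdivide z⟩

instance : CompleteSpace U₀.{u} := inferInstanceAs (CompleteSpace UnitSquare.{u})

end SquaMS

/-- The unit square with the taxicab metric and `α_N` is a corecursive algebra for `N ⊗ -` on
square metric spaces; `α_N` is invertible and `(U₀, α_N⁻¹)` is a final coalgebra; and for every
coalgebra of square metric spaces there is exactly one solution among all maps of square sets,
and it is short. -/
theorem mainTheorem4 :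
    IsCorecursiveAlgebra (⟨SquaMS.U₀.{u}, SquaMS.alphaN⟩ : Endofunctor.Algebra SquaMS.tensorN.{u}) ∧
    (∃ e : SquaMS.tensorN.obj SquaMS.U₀.{u} ≅ SquaMS.U₀.{u}, e.hom = SquaMS.alphaN ∧
      Nonempty (Limits.IsTerminal
        (⟨SquaMS.U₀.{u}, e.inv⟩ : Endofunctor.Coalgebra SquaMS.tensorN.{u}))) ∧
    (∀ B : Endofunctor.Coalgebra SquaMS.tensorN.{u},
      (∃! f : SquaMS.SetHom B.V SquaMS.U₀.{u},
        ∀ b, f.toFun b = SquaMS.alphaN.toFun (SquaMS.tensorMap f (B.str.toFun b))) ∧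
      ∀ f : SquaMS.SetHom B.V SquaMS.U₀.{u},
        (∀ b, f.toFun b = SquaMS.alphaN.toFun (SquaMS.tensorMap f (B.str.toFun b))) →
        ∀ b c, dist (f.toFun b) (f.toFun c) ≤ dist b c) := by
  have corecursive := SquaMS.isCorecursiveAlgebra_of_completeSpace
    (⟨SquaMS.U₀.{u}, SquaMS.alphaN⟩ : Endofunctor.Algebra SquaMS.tensorN.{u}) SquaMS.nonempty_hom_U₀
  refine ⟨corecursive, ⟨asIso SquaMS.alphaN, rfl, corecursive.nonempty_isTerminal⟩, fun B => ?_⟩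
  obtain ⟨f, hf⟩ :=
    SquaMS.exists_hom_isSolution B.str SquaMS.alphaN (SquaMS.nonempty_hom_U₀ B.V)
  refine ⟨⟨f.toSetHom, hf, fun g hg => SquaMS.IsSolution.eq hg hf⟩, fun g hg => ?_⟩
  rw [SquaMS.IsSolution.eq hg hf]
  exact f.short
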